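/- For a probability distribution $P$ on a finite set write $IC(P)=\sum_x P(x)^2$ for its collision probability and $H(P)=-\sum_x P(x)\ln P(x)$ (with $0\ln 0=0$) for its Shannon entropy. For $0<k\le 1$ put $\mathfrak K=\lfloor 1/k\rfloor$, $$p(k)=\frac{\mathfrak K+\sqrt{\mathfrak K\,(k+\mathfrak K k-1)}}{\mathfrak K^2+\mathfrak K},\qquad q(k)=1-\frac{\mathfrak K+\sqrt{\mathfrak K\,(k+\mathfrak K k-1)}}{\mathfrak K+1}=1-\mathfrak K\,p(k),$$ and let $\tilde H(k)=-q(k)\ln q(k)-\mathfrak K\,p(k)\ln p(k)$, i.e. the Shannon entropy of the distribution with $\mathfrak K$ probabilities equal to $p(k)$ and one equal to $q(k)$. Let $M\ge 1$ be an integer, let $0<k_{tot}\le M$ be real, and let $\mathcal X_1,\dots,\mathcal X_M$ be finite sets whose sizes $d_i=|\mathcal X_i|$ satisfy $d_i\ge\lceil M/k_{tot}\rceil$ for all $i$. Put $$k_{min}=\frac{1}{\lceil M/k_{tot}\rceil},\qquad k_{max}=\frac{1}{\lfloor M/k_{tot}\rfloor},\qquad \Phi=\left\lfloor\frac{k_{tot}-M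 k_{max}}{k_{min}-k_{max}}\right\rfloor ,$$ where $\Phi=0$ by convention if $M/k_{tot}$ is an integer (then $k_{min}=k_{max}$ and the value $B$ below does not depend on $\Phi$), and $$B=\Phi\,\tilde H(k_{min})+(M-1-\Phi)\,\tilde H(k_{max})+\tilde H\bigl(k_{tot}-\Phi k_{min}-(M-1-\Phi)k_{max}\bigr).$$ Then: 1. For all probability distributions $P_1,\dots,P_M$ on $\mathcal X_1,\dots,\mathcal X_M$ with $\sum_{i=1}^M IC(P_i)\le k_{tot}$ we have $\sum_{i=1}^M H(P_i)\ge B$. 2. The bound is tight: there are probability distributions $P'_1,\dots,P'_M$ on $\mathcal X_1,\dots,\mathcal X_M$ with $\sum_{i=1}^M IC(P'_i)\le k_{tot}$ and $\sum_{i=1}^M H(P'_i)=B$. -/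

import Mathlib

namespace CollisionEntropy

noncomputable section

/-- Collision probability `IC(P) = ∑ₓ P(x)²` of a distribution on a finite set. -/
def collisionProb {α : Type*} [Fintype α] (P : α → ℝ) : ℝ :=
  ∑ x, P x ^ 2

/-- Shannon entropy `H(P) = -∑ₓ P(x) ln P(x)` (natural logarithm, `0 ln 0 = 0`). -/
def shannonEntropy {α : Type*} [Fintype α] (P : α → ℝ) : ℝ :=
  ∑ x, Real.negMulLog (P x)

/-- The integer `𝔎 = ⌊1/k⌋`. -/
def arcIndex (k : ℝ) : ℕ :=
  ⌊1 / k⌋₊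

/-- The `𝔎` equal large probabilities
`(𝔎 + √(𝔎 (k + 𝔎 k - 1))) / (𝔎² + 𝔎)` of the extremal distribution. -/
def bigProb (k : ℝ) : ℝ :=
  ((arcIndex k : ℝ) + √((arcIndex k : ℝ) * (k + (arcIndex k : ℝ) * k - 1))) /
    ((arcIndex k : ℝ) ^ 2 + (arcIndex k : ℝ))

/-- The one remaining probability
`1 - (𝔎 + √(𝔎 (k + 𝔎 k - 1))) / (𝔎 + 1)` of the extremal distribution. -/
def smallProb (k : ℝ) : ℝ :=
  1 - ((arcIndex k : ℝ) + √((arcIndex k : ℝ) * (k + (arcIndex k : ℝ) * k - 1))) /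
    ((arcIndex k : ℝ) + 1)

/-- `H̃(k)`: the Shannon entropy of the distribution with `𝔎` probabilities equal to `bigProb k`,
one equal to `smallProb k`, and all others zero. -/
def Htilde (k : ℝ) : ℝ :=
  -(smallProb k * Real.log (smallProb k)) -
    bigProb k * Real.log (bigProb k) * (arcIndex k : ℝ)

/-- `k_min = 1 / ⌈M / k_tot⌉`. -/
def kMin (M : ℕ) (ktot : ℝ) : ℝ :=
  1 / (⌈(M : ℝ) / ktot⌉₊ : ℝ)

/-- `k_max = 1 / ⌊M / k_tot⌋` (used for `0 < k_tot ≤ M`, so the denominator is positive). -/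
def kMax (M : ℕ) (ktot : ℝ) : ℝ :=
  1 / (⌊(M : ℝ) / ktot⌋₊ : ℝ)

/-- `Φ = ⌊(k_tot - M k_max) / (k_min - k_max)⌋`. If `M / k_tot` is an integer, then
`k_min = k_max` and the quotient is undefined; we then put `Φ = 0` (in that case the quantity
`entropyBound` below does not depend on `Φ`). -/
def Phi (M : ℕ) (ktot : ℝ) : ℤ :=
  if kMin M ktot = kMax M ktot then 0
  else ⌊(ktot - (M : ℝ) * kMax M ktot) / (kMin M ktot - kMax M ktot)⌋

/-- `Φ H̃(k_min) + (M - 1 - Φ) H̃(k_max) + H̃(k_tot - Φ k_min - (M - 1 - Φ) k_max)`. -/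
def entropyBound (M : ℕ) (ktot : ℝ) : ℝ :=
  (Phi M ktot : ℝ) * Htilde (kMin M ktot)
    + ((M : ℝ) - 1 - (Phi M ktot : ℝ)) * Htilde (kMax M ktot)
    + Htilde (ktot - (Phi M ktot : ℝ) * kMin M ktot
        - ((M : ℝ) - 1 - (Phi M ktot : ℝ)) * kMax M ktot)

end

end CollisionEntropy

namespace CollisionEntropy

/-! For one distribution, minimising the entropy at fixed collision probability `k` leaves all
positive probabilities equal except possibly one smaller one (`exists_lower_entropy_triple`,
`exists_arc_le_entropy`). The minimal entropy is therefore a chain of arcs, the `K`-th over `1/(K+1)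
≤ k ≤ 1/K`; with `t = 1/K - k` it is `log K + excess K t`, which is concave in `t`.

Lowering `k` from 1 traverses the arcs `K = 1, 2, …` in turn: the length covered is `1 - k`, the
cost collected is the entropy. For `M` distributions this is a partial filling of `M` copies of
every arc, of total length at least `M - ktot`, whose cost is to be minimised. Two exchange
inequalities (`excess_add_le`, `excess_full_add_le`) show that moving length to an earlier arc,
until that one is full or the later one empty, never costs more. Hence filling in order is optimal
(`exists_greedy_filling`), and its cost grows with the length (`greedy_cost_mono`). The greedy
filling of length exactly `M - ktot` costs `B`: every distribution sits at `k_min` or `k_max`,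
except one in between (`entropyBound_eq`). Tightness follows because each point of the curve is
realised on a large enough set. -/

/-- The smaller of the two distinct probabilities in the distribution with `K` equal large
probabilities and one small one, whose collision probability is `1 / K - t`. -/
noncomputable def tailProb (K t : ℝ) : ℝ :=
  (1 - √(1 - K * (K + 1) * t)) / (K + 1)

/-- The amount by which the entropy of the distribution with `K` equal large probabilities and
small probability `tailProb K t` exceeds `log K`. -/
noncomputable def excess (K t : ℝ) : ℝ :=
  Real.binEntropy (tailProb K t) - tailProb K t * Real.log K

/-- The length of the interval `[1 / (K + 1), 1 / K]`. -/
noncomputable def arcLength (K : ℝ) : ℝ := 1 / (K * (K + 1))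

/-- The derivative of `excess K`, as a function of `u = √(1 - K (K + 1) t)`. -/
noncomputable def arcSlope (K u : ℝ) : ℝ :=
  K * (Real.log (K + u) - Real.log K - Real.log (1 - u)) / (2 * u)

/-! ### The shape of a single arc -/

lemma tailProb_zero (K : ℝ) : tailProb K 0 = 0 := by simp [tailProb]

lemma excess_zero (K : ℝ) : excess K 0 = 0 := by simp [excess, tailProb_zero]

lemma arcLength_pos {K : ℝ} (hK : 0 < K) : 0 < arcLength K := by unfold arcLength; positivity

lemma le_arcLength_iff {K t : ℝ} (hK : 0 < K) : t ≤ arcLength K ↔ K * (K + 1) * t ≤ 1 := by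
  unfold arcLength
  rw [le_div_iff₀ (by positivity), mul_comm]

lemma lt_arcLength_iff {K t : ℝ} (hK : 0 < K) : t < arcLength K ↔ K * (K + 1) * t < 1 := by
  unfold arcLength
  rw [lt_div_iff₀ (by positivity), mul_comm]

lemma arcLength_anti {a b : ℝ} (ha : 0 < a) (hab : a ≤ b) : arcLength b ≤ arcLength a := by
  have hb : 0 < b := ha.trans_le hab
  unfold arcLength
  gcongr

lemma tailProb_arcLength {K : ℝ} (hK : 0 < K) : tailProb K (arcLength K) = 1 / (K + 1) := by
  have : K * (K + 1) * arcLength K = 1 := by unfold arcLength; field_simp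
  simp [tailProb, this]

/-- Chain rule for entropy: split off the atom `q`, then spread the mass `1 - q` uniformly over `K`
atoms. -/
lemma binEntropy_tail_eq {K q : ℝ} (hK : 0 < K) :
    Real.log K + (Real.binEntropy q - q * Real.log K) =
      Real.negMulLog q + K * Real.negMulLog ((1 - q) / K) := by
  rw [Real.binEntropy_eq_negMulLog_add_negMulLog_one_sub]
  rcases eq_or_ne q 1 with rfl | hq
  · simp
  · have h1 : 1 - q ≠ 0 := sub_ne_zero.2 hq.symm
    simp only [Real.negMulLog]
    rw [Real.log_div h1 hK.ne']
    field_simp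
    ring

lemma excess_arcLength {K : ℝ} (hK : 0 < K) :
    excess K (arcLength K) = Real.log (K + 1) - Real.log K := by
  have h := binEntropy_tail_eq (q := 1 / (K + 1)) hK
  have h2 : (1 - 1 / (K + 1)) / K = 1 / (K + 1) := by field_simp; ring
  rw [h2] at h
  unfold excess
  rw [tailProb_arcLength hK]
  have h3 : Real.negMulLog (1 / (K + 1)) + K * Real.negMulLog (1 / (K + 1)) =
      Real.log (K + 1) := by
    simp only [Real.negMulLog, one_div, Real.log_inv]
    field_simp
    ring
  linarith

lemma continuous_excess (K : ℝ) : Continuous (excess K) := by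
  unfold excess tailProb
  have := Real.binEntropy_continuous
  fun_prop

lemma hasDerivAt_excess {K t : ℝ} (hK : 0 < K) (ht : 0 < t) (ht' : t < arcLength K) :
    HasDerivAt (excess K) (arcSlope K √(1 - K * (K + 1) * t)) t := by
  rw [lt_arcLength_iff hK] at ht'
  have hu : 0 < 1 - K * (K + 1) * t := by linarith
  have hu1 : 1 - K * (K + 1) * t < 1 := by
    have : 0 < K * (K + 1) * t := by positivity
    linarith
  have hd : HasDerivAt (fun t => √(1 - K * (K + 1) * t))
      (-(K * (K + 1)) / (2 * √(1 - K * (K + 1) * t))) t := by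
    have := ((hasDerivAt_id t).const_mul (K * (K + 1))).const_sub 1
    simpa using this.sqrt hu.ne'
  have hs : 0 < √(1 - K * (K + 1) * t) := Real.sqrt_pos.2 hu
  have hs1 : √(1 - K * (K + 1) * t) < 1 := by
    rw [Real.sqrt_lt' one_pos]; linarith
  have hq : HasDerivAt (tailProb K) (-(-(K * (K + 1)) / (2 * √(1 - K * (K + 1) * t))) / (K + 1)) t :=
    (hd.const_sub 1).div_const (K + 1)
  have hqdef : tailProb K t = (1 - √(1 - K * (K + 1) * t)) / (K + 1) := rfl
  set u := √(1 - K * (K + 1) * t) with hu_def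
  have h1q : 1 - tailProb K t = (K + u) / (K + 1) := by rw [hqdef]; field_simp; ring
  have hq0 : tailProb K t ≠ 0 := by
    rw [hqdef]; exact (div_pos (by linarith) (by linarith)).ne'
  have hq1 : tailProb K t ≠ 1 := by
    intro h
    rw [h] at h1q
    have : 0 < (K + u) / (K + 1) := by positivity
    linarith
  have hb := (Real.hasDerivAt_binEntropy hq0 hq1).comp t hq
  refine (hb.sub (hq.mul_const (Real.log K))).congr_deriv ?_
  rw [h1q, hqdef, Real.log_div (by positivity) (by positivity),
    Real.log_div (by linarith) (by positivity)]
  unfold arcSlope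
  field_simp
  ring

lemma log_slope_anti {p q p' q' : ℝ} (hq' : 0 < q') (hqq : q' ≤ q) (hpp : p' ≤ p) (hqp : q < p)
    (hqp' : q' < p') :
    (Real.log p - Real.log q) / (p - q) ≤ (Real.log p' - Real.log q') / (p' - q') := by
  have hc := strictConcaveOn_log_Ioi.concaveOn
  have hq : 0 < q := hq'.trans_le hqq
  have h1 := hc.slope_anti (x := p) (Set.mem_Ioi.2 (hq.trans hqp))
    (a := q') ⟨hq', (hqp'.trans_le hpp).ne⟩ (b := q) ⟨hq, hqp.ne⟩ hqq
  have h2 := hc.slope_anti (x := q') hq'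
    (a := p') ⟨hq'.trans hqp', hqp'.ne'⟩ (b := p) ⟨hq.trans hqp, (hqp'.trans_le hpp).ne'⟩ hpp
  rw [slope_comm, slope_comm Real.log p] at h1
  simp only [slope_def_field] at h1 h2
  exact h1.trans h2

/-- With `p` the large and `q` the small probability, `dH = (log p - log q) dq` and `dt = 2 (p - q)
dq` along an arc. The slope is thus half a chord slope of `log`, a form in which different `K` can
be compared. -/
lemma arcSlope_eq {K u : ℝ} (hK : 0 < K) (hu : 0 < u) (hu1 : u < 1) :
    arcSlope K u = (Real.log ((1 + u / K) / (K + 1)) - Real.log ((1 - u) / (K + 1))) /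
      ((1 + u / K) / (K + 1) - (1 - u) / (K + 1)) / 2 := by
  have h1 : (1 + u / K) / (K + 1) - (1 - u) / (K + 1) = u / K := by field_simp; ring
  have h2 : 1 + u / K = (K + u) / K := by field_simp
  rw [h1, h2, Real.log_div (by positivity) (by positivity), Real.log_div (by positivity) hK.ne',
    Real.log_div (by linarith) (by positivity)]
  unfold arcSlope
  field_simp
  ring

lemma arcSlope_nonneg {K u : ℝ} (hK : 0 < K) (hu : 0 < u) (hu1 : u < 1) : 0 ≤ arcSlope K u := by
  unfold arcSlope
  have h1 : Real.log K ≤ Real.log (K + u) := Real.log_le_log hK (by linarith)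
  have h2 : Real.log (1 - u) ≤ 0 := Real.log_nonpos (by linarith) (by linarith)
  apply div_nonneg (mul_nonneg hK.le (by linarith)) (by linarith)

/-- Up to the factor `K / 2` this is the chord slope from 0 of a function vanishing at 0; that
function is convex because `1 - u ≤ K + u`, where `1 ≤ K` enters. As `u` decreases in `t`, concavity
of `excess K` results. -/
lemma arcSlope_monotoneOn {K : ℝ} (hK : 1 ≤ K) : MonotoneOn (arcSlope K) (Set.Ioo 0 1) := by
  have hK0 : 0 < K := by linarith
  have hd : ∀ u ∈ Set.Ico (0 : ℝ) 1, HasDerivAt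
      (fun u => Real.log (K + u) - Real.log K - Real.log (1 - u))
      (1 / (K + u) + 1 / (1 - u)) u := by
    intro u hu
    have h1 : HasDerivAt (fun u => Real.log (K + u)) (1 / (K + u)) u :=
      ((hasDerivAt_id u).const_add K).log (by have := hu.1; simp; linarith)
    have h2 : HasDerivAt (fun u => Real.log (1 - u)) (-1 / (1 - u)) u :=
      ((hasDerivAt_id u).const_sub 1).log (by have := hu.2; simp; linarith)
    exact ((h1.sub_const _).sub h2).congr_deriv (by ring)
  have hconv : ConvexOn ℝ (Set.Ico (0 : ℝ) 1)
      (fun u => Real.log (K + u) - Real.log K - Real.log (1 - u)) := by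
    apply MonotoneOn.convexOn_of_deriv (convex_Ico 0 1)
      (fun u hu => (hd u hu).continuousAt.continuousWithinAt)
    · intro u hu
      rw [interior_Ico] at hu
      exact (hd u ⟨hu.1.le, hu.2⟩).differentiableAt.differentiableWithinAt
    · rw [interior_Ico]
      intro u hu v hv huv
      rw [(hd u ⟨hu.1.le, hu.2⟩).deriv, (hd v ⟨hv.1.le, hv.2⟩).deriv]
      have h1u : 0 < 1 - u := by linarith [hu.2]
      have h1v : 0 < 1 - v := by linarith [hv.2]
      have h0u : 0 < K + u := by linarith [hu.1]
      have h0v : 0 < K + v := by linarith [hv.1]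
      have e1 : 1 / (K + u) - 1 / (K + v) = (v - u) / ((K + u) * (K + v)) := by
        field_simp; ring
      have e2 : 1 / (1 - v) - 1 / (1 - u) = (v - u) / ((1 - u) * (1 - v)) := by
        field_simp; ring
      have : (v - u) / ((K + u) * (K + v)) ≤ (v - u) / ((1 - u) * (1 - v)) := by
        apply div_le_div_of_nonneg_left (by linarith) (by positivity)
        apply mul_le_mul <;> linarith [hu.1, hv.1]
      linarith
  have hm := hconv.slope_mono (x := 0) ⟨le_rfl, one_pos⟩
  intro u hu v hv huv
  have := hm (a := u) ⟨⟨hu.1.le, hu.2⟩, hu.1.ne'⟩ (b := v) ⟨⟨hv.1.le, hv.2⟩, hv.1.ne'⟩ huv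
  simp only [slope_def_field, add_zero, sub_self, sub_zero, Real.log_one] at this
  have e : ∀ w, arcSlope K w =
      K / 2 * ((Real.log (K + w) - Real.log K - Real.log (1 - w)) / w) := by
    intro w
    unfold arcSlope
    rw [div_mul_div_comm]
  rw [e, e]
  exact mul_le_mul_of_nonneg_left this (by positivity)

lemma sqrt_mem_Ioo {K t : ℝ} (hK : 0 < K) (ht : t ∈ Set.Ioo 0 (arcLength K)) :
    √(1 - K * (K + 1) * t) ∈ Set.Ioo (0 : ℝ) 1 := by
  have h2 := (lt_arcLength_iff hK).1 ht.2
  have h1 := ht.1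
  have : 0 < K * (K + 1) * t := by positivity
  exact ⟨Real.sqrt_pos.2 (by linarith), by rw [Real.sqrt_lt' one_pos]; linarith⟩

lemma excess_concaveOn {K : ℝ} (hK : 1 ≤ K) :
    ConcaveOn ℝ (Set.Icc 0 (arcLength K)) (excess K) := by
  have hK0 : 0 < K := by linarith
  apply AntitoneOn.concaveOn_of_deriv (convex_Icc _ _) (continuous_excess K).continuousOn
  · intro t ht
    rw [interior_Icc] at ht
    exact (hasDerivAt_excess hK0 ht.1 ht.2).differentiableAt.differentiableWithinAt
  · rw [interior_Icc]
    intro s hs t ht hst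
    rw [(hasDerivAt_excess hK0 hs.1 hs.2).deriv, (hasDerivAt_excess hK0 ht.1 ht.2).deriv]
    apply arcSlope_monotoneOn hK (sqrt_mem_Ioo hK0 ht) (sqrt_mem_Ioo hK0 hs)
    gcongr

lemma excess_monotoneOn {K : ℝ} (hK : 0 < K) :
    MonotoneOn (excess K) (Set.Icc 0 (arcLength K)) := by
  apply monotoneOn_of_deriv_nonneg (convex_Icc _ _) (continuous_excess K).continuousOn
  · intro t ht
    rw [interior_Icc] at ht
    exact (hasDerivAt_excess hK ht.1 ht.2).differentiableAt.differentiableWithinAt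
  · intro t ht
    rw [interior_Icc] at ht
    rw [(hasDerivAt_excess hK ht.1 ht.2).deriv]
    have := sqrt_mem_Ioo hK ht
    exact arcSlope_nonneg hK this.1 this.2

/-! ### Comparing arcs of different index -/

/-- Measured from their left end points, the arcs become steeper as `K` grows. -/
lemma excess_drop_mono {a b r : ℝ} (ha : 0 < a) (hab : a ≤ b) (hr : 0 ≤ r)
    (hr' : r ≤ arcLength b) :
    excess a (arcLength a) - excess a (arcLength a - r) ≤
      excess b (arcLength b) - excess b (arcLength b - r) := by
  have hb : 0 < b := by linarith
  have hder : ∀ K, 0 < K → ∀ r ∈ Set.Ioo 0 (arcLength K),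
      HasDerivAt (fun r => excess K (arcLength K - r)) (-arcSlope K √(K * (K + 1) * r)) r := by
    intro K hK r hr
    have h := hasDerivAt_excess hK (t := arcLength K - r) (by linarith [hr.2]) (by linarith [hr.1])
    have e : 1 - K * (K + 1) * (arcLength K - r) = K * (K + 1) * r := by
      unfold arcLength; field_simp; ring
    rw [e] at h
    exact (h.comp r ((hasDerivAt_id r).const_sub (arcLength K))).congr_deriv (by ring)
  have hmono : MonotoneOn
      (fun r => excess a (arcLength a - r) - excess b (arcLength b - r))
      (Set.Icc 0 (arcLength b)) := by
    have hsub : ∀ r ∈ interior (Set.Icc 0 (arcLength b)), HasDerivAt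
        (fun r => excess a (arcLength a - r) - excess b (arcLength b - r))
        (-arcSlope a √(a * (a + 1) * r) - -arcSlope b √(b * (b + 1) * r)) r := by
      intro r hr
      rw [interior_Icc] at hr
      exact (hder a ha r ⟨hr.1, hr.2.trans_le (arcLength_anti ha hab)⟩).sub (hder b hb r hr)
    apply monotoneOn_of_deriv_nonneg (convex_Icc _ _)
    · have h1 := continuous_excess a
      have h2 := continuous_excess b
      fun_prop
    · exact fun r hr => (hsub r hr).differentiableAt.differentiableWithinAt
    · intro r hr
      rw [(hsub r hr).deriv]
      rw [interior_Icc] at hr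
      have hr0 := hr.1
      have hb1 := (lt_arcLength_iff hb).1 hr.2
      have ha1 := (lt_arcLength_iff ha).1 (hr.2.trans_le (arcLength_anti ha hab))
      have hua : 0 < √(a * (a + 1) * r) := Real.sqrt_pos.2 (by positivity)
      have hub : 0 < √(b * (b + 1) * r) := Real.sqrt_pos.2 (by positivity)
      have hua1 : √(a * (a + 1) * r) < 1 := by rw [Real.sqrt_lt' one_pos]; linarith
      have hub1 : √(b * (b + 1) * r) < 1 := by rw [Real.sqrt_lt' one_pos]; linarith
      -- At fixed `r`, passing from `a` to `b` raises `u` but lowers `u / K`. Both probabilities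
      -- therefore fall, and chords of `log` get steeper to the left.
      have hle : √(a * (a + 1) * r) ≤ √(b * (b + 1) * r) := by gcongr
      have hle' : √(b * (b + 1) * r) / b ≤ √(a * (a + 1) * r) / a := by
        rw [div_le_div_iff₀ hb ha]
        apply le_of_sq_le_sq _ (by positivity)
        rw [mul_pow, mul_pow, Real.sq_sqrt (by positivity), Real.sq_sqrt (by positivity)]
        have : 0 ≤ a * b * r * (b - a) := by
          apply mul_nonneg (by positivity) (by linarith)
        nlinarith
      have := log_slope_anti (p := (1 + √(a * (a + 1) * r) / a) / (a + 1))
        (q := (1 - √(a * (a + 1) * r)) / (a + 1))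
        (p' := (1 + √(b * (b + 1) * r) / b) / (b + 1))
        (q' := (1 - √(b * (b + 1) * r)) / (b + 1))
        (div_pos (by linarith) (by linarith))
        (div_le_div₀ (by linarith) (by linarith) (by linarith) (by linarith))
        (div_le_div₀ (by positivity) (by linarith) (by linarith) (by linarith))
        (div_lt_div_of_pos_right (by have : 0 < √(a * (a + 1) * r) / a := by positivity
                                     linarith) (by linarith))
        (div_lt_div_of_pos_right (by have : 0 < √(b * (b + 1) * r) / b := by positivity
                                     linarith) (by linarith))
      rw [arcSlope_eq ha hua hua1, arcSlope_eq hb hub hub1]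
      linarith
  have := hmono ⟨le_rfl, (arcLength_pos hb).le⟩ ⟨hr, hr'⟩ hr
  simp only [sub_zero] at this
  linarith

/-- Measured from their right end points, the arcs become higher as `K` grows. -/
lemma excess_mono_index {a b t : ℝ} (ha : 0 < a) (hab : a ≤ b) (ht : 0 ≤ t)
    (ht' : t ≤ arcLength b) : excess a t ≤ excess b t := by
  rcases ht.eq_or_lt with rfl | ht
  · simp [excess_zero]
  have hb : 0 < b := by linarith
  rw [le_arcLength_iff hb] at ht'
  -- The index is treated as a real variable, so that the arcs can be differentiated in `K` at fixed
  -- `t`.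
  have hder : ∀ K ∈ Set.Ioo a b, ∃ d, 0 ≤ d ∧ HasDerivAt (fun K => excess K t) d K := by
    intro K hK
    have hK0 : 0 < K := ha.trans hK.1
    have hKb := hK.2
    have h1 : K * (K + 1) * t < 1 := by
      have : K * (K + 1) * t < b * (b + 1) * t := by gcongr
      linarith
    have hu2 : 0 < 1 - K * (K + 1) * t := by linarith
    have hpos : 0 < K * (K + 1) * t := by positivity
    have hd : HasDerivAt (fun K => √(1 - K * (K + 1) * t))
        (-((2 * K + 1) * t) / (2 * √(1 - K * (K + 1) * t))) K := by
      have h : HasDerivAt (fun K => 1 - K * (K + 1) * t) (-((2 * K + 1) * t)) K :=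
        ((((hasDerivAt_id K).mul ((hasDerivAt_id K).add_const 1)).mul_const t).const_sub
          1).congr_deriv (by simp only [id]; ring)
      exact h.sqrt hu2.ne'
    have hq := (hd.const_sub 1).div ((hasDerivAt_id K).add_const 1) (by simp; linarith)
    have hqe : (fun K => tailProb K t) =
      ((fun x => 1 - √(1 - x * (x + 1) * t)) / fun x => id x + 1) := rfl
    rw [← hqe] at hq
    have hu : 0 < √(1 - K * (K + 1) * t) := Real.sqrt_pos.2 hu2
    have hu1 : √(1 - K * (K + 1) * t) < 1 := by rw [Real.sqrt_lt' one_pos]; linarith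
    have hqdef : tailProb K t = (1 - √(1 - K * (K + 1) * t)) / (K + 1) := rfl
    have hsq : √(1 - K * (K + 1) * t) ^ 2 = 1 - K * (K + 1) * t := Real.sq_sqrt hu2.le
    simp only [id] at hq
    set u := √(1 - K * (K + 1) * t) with hu_def
    set q := tailProb K t with hq_def
    have hteq : t = (1 - u ^ 2) / (K * (K + 1)) := by
      rw [hsq]; field_simp; ring
    have hueq : u = 1 - (K + 1) * q := by rw [hqdef]; field_simp; ring
    have hq0 : 0 < q := by rw [hqdef]; exact div_pos (by linarith) (by linarith)
    have hKq : 0 < 1 - q - K * q := by linarith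
    have hKq0 : 0 < K * q := by positivity
    have hq1 : 0 < 1 - q := by linarith
    have hlog := hasDerivAt_id K |>.log hK0.ne'
    have hE := ((Real.hasDerivAt_binEntropy (p := q) hq0.ne' (by linarith)).comp K hq).sub
      (hq.mul hlog)
    refine ⟨_, ?_, hE⟩
    have hval : (-(-((2 * K + 1) * t) / (2 * u)) * (K + 1) - (1 - u) * 1) / (K + 1) ^ 2 =
        q * (2 - q) / (2 * K * u) := by
      rw [hteq, hqdef]
      field_simp
      ring
    simp only [id]
    rw [hval]
    -- The bound `log x ≥ 2 (x - 1) / (x + 1)` at the ratio `x` of large to small probability: its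
    -- numerator cancels the `u` in the denominator of `dq/dK`, and only `K q ≤ 1` remains to be
    -- used.
    have hln := Real.le_log_one_add_of_nonneg (x := (1 - q) / (K * q) - 1)
      (by rw [sub_nonneg, le_div_iff₀ hKq0]; linarith)
    rw [add_sub_cancel, Real.log_div hq1.ne' hKq0.ne', Real.log_mul hK0.ne' hq0.ne'] at hln
    have e1 : 2 * ((1 - q) / (K * q) - 1) / ((1 - q) / (K * q) - 1 + 2) =
        2 * u / (1 - q + K * q) := by
      rw [hueq]
      have : 1 - q + K * q ≠ 0 := by positivity
      have h3 : (1 - q) / (K * q) - 1 + 2 = (1 - q + K * q) / (K * q) := by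
        field_simp; ring
      have h4 : (1 - q) / (K * q) - 1 = (1 - (K + 1) * q) / (K * q) := by
        field_simp; ring
      rw [h3, h4]
      field_simp
    rw [e1] at hln
    have h5 : q * (2 - q) / (2 * K * u) * (2 * u / (1 - q + K * q)) ≤
        q * (2 - q) / (2 * K * u) * (Real.log (1 - q) - (Real.log K + Real.log q)) := by
      apply mul_le_mul_of_nonneg_left hln
      apply div_nonneg (mul_nonneg hq0.le (by linarith)) (by positivity)
    have h6 : q / K ≤ q * (2 - q) / (2 * K * u) * (2 * u / (1 - q + K * q)) := by
      have : q * (2 - q) / (2 * K * u) * (2 * u / (1 - q + K * q)) =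
          q / K * ((2 - q) / (1 - q + K * q)) := by field_simp
      rw [this]
      apply le_mul_of_one_le_right (by positivity)
      rw [one_le_div (by positivity)]
      linarith
    have h7 : q * (1 / K) = q / K := by ring
    linarith
  have hcont : ContinuousOn (fun K => excess K t) (Set.Icc a b) := by
    have hlog : ContinuousOn Real.log (Set.Icc a b) :=
      Real.continuousOn_log.mono (fun x hx => (ha.trans_le hx.1).ne')
    have htail : ContinuousOn (fun K => tailProb K t) (Set.Icc a b) := by
      unfold tailProb
      apply ContinuousOn.div (by fun_prop) (by fun_prop)
      intro x hx
      linarith [hx.1]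
    exact (Real.binEntropy_continuous.comp_continuousOn htail).sub (htail.mul hlog)
  have := monotoneOn_of_deriv_nonneg (convex_Icc a b) hcont
    (by
      intro K hK
      rw [interior_Icc] at hK
      obtain ⟨d, -, hd⟩ := hder K hK
      exact hd.differentiableAt.differentiableWithinAt)
    (by
      intro K hK
      rw [interior_Icc] at hK
      obtain ⟨d, h0, hd⟩ := hder K hK
      rwa [hd.deriv])
  exact this ⟨le_rfl, hab⟩ ⟨hab, le_rfl⟩ hab

/-! ### Perturbing three probabilities -/

/-- Three probabilities `y ≥ z > 0`, `x > y` can be changed so that their sum and their sum of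
squares are kept and their entropy drops. -/
lemma exists_lower_entropy_triple {x y z : ℝ} (hz : 0 < z) (hzy : z ≤ y) (hyx : y < x) :
    ∃ x' y' z' : ℝ, 0 ≤ x' ∧ 0 ≤ y' ∧ 0 ≤ z' ∧ x' + y' + z' = x + y + z ∧
      x' ^ 2 + y' ^ 2 + z' ^ 2 = x ^ 2 + y ^ 2 + z ^ 2 ∧
      Real.negMulLog x' + Real.negMulLog y' + Real.negMulLog z' <
        Real.negMulLog x + Real.negMulLog y + Real.negMulLog z := by
  -- The smallest value `w` parametrises the curve of fixed sum and sum of squares; the other two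
  -- are roots of a quadratic, and `D w` is their squared difference.
  obtain ⟨D, hD⟩ : ∃ D : ℝ → ℝ, D = fun w =>
      2 * (x ^ 2 + y ^ 2 + z ^ 2 - w ^ 2) - (x + y + z - w) ^ 2 := ⟨_, rfl⟩
  have hDz : D z = (x - y) ^ 2 := by rw [hD]; ring
  have hDc : Continuous D := by rw [hD]; fun_prop
  have hev : ∀ᶠ w in nhds z, 0 < D w ∧ 0 < w :=
    (hDc.continuousAt.eventually_const_lt (by rw [hDz]; nlinarith)).and
      (eventually_gt_nhds hz)
  obtain ⟨ε, hε, hball⟩ := Metric.eventually_nhds_iff.1 hev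
  obtain ⟨X, hX⟩ : ∃ X : ℝ → ℝ, X = fun w => (x + y + z - w + √(D w)) / 2 := ⟨_, rfl⟩
  obtain ⟨Y, hY⟩ : ∃ Y : ℝ → ℝ, Y = fun w => (x + y + z - w - √(D w)) / 2 := ⟨_, rfl⟩
  have hgood : ∀ w ∈ Set.Icc (z - ε / 2) z, 0 < D w ∧ 0 < w := by
    intro w hw
    apply hball
    rw [Real.dist_eq, abs_lt]
    constructor <;> linarith [hw.1, hw.2]
  have hXY : ∀ w ∈ Set.Icc (z - ε / 2) z, Y w < X w := by
    intro w hw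
    have := Real.sqrt_pos.2 (hgood w hw).1
    rw [hX, hY]
    simp only
    linarith
  -- Strictness fails at `w = z` when `z = y`, hence the half-open interval; monotonicity needs the
  -- derivative only in the interior.
  have hYw : ∀ w ∈ Set.Ico (z - ε / 2) z, w < Y w := by
    intro w hw
    have h : √(D w) < x + y + z - 3 * w := by
      rw [Real.sqrt_lt' (by linarith [hw.2]), hD]
      simp only
      nlinarith [mul_nonneg (sub_nonneg.2 (hzy.trans hyx.le)) (sub_nonneg.2 hzy),
        mul_pos (sub_pos.2 hw.2) (sub_pos.2 (hw.2.trans_le hzy)),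
        mul_pos (sub_pos.2 hw.2) (sub_pos.2 (hw.2.trans_le (hzy.trans hyx.le))),
        mul_pos (sub_pos.2 hw.2) (sub_pos.2 hw.2)]
    rw [hY]
    simp only
    linarith
  have hXz : X z = x := by
    rw [hX]; simp only; rw [hDz, Real.sqrt_sq (by linarith)]; ring
  have hYz : Y z = y := by
    rw [hY]; simp only; rw [hDz, Real.sqrt_sq (by linarith)]; ring
  have hder : ∀ w ∈ Set.Ioo (z - ε / 2) z,
      HasDerivAt X ((w - Y w) / (Y w - X w)) w ∧ HasDerivAt Y ((X w - w) / (Y w - X w)) w := by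
    intro w hw
    have hg := hgood w ⟨hw.1.le, hw.2.le⟩
    have hs := Real.sqrt_pos.2 hg.1
    have hd : HasDerivAt D (2 * (x + y + z - w) - 4 * w) w := by
      rw [hD]
      have := (((hasDerivAt_pow 2 w).const_sub (x ^ 2 + y ^ 2 + z ^ 2)).const_mul 2).sub
        (((hasDerivAt_id w).const_sub (x + y + z)).pow 2)
      exact this.congr_deriv (by simp; ring)
    have hsd := hd.sqrt hg.1.ne'
    have e : Y w - X w = -√(D w) := by rw [hX, hY]; ring
    rw [e]
    constructor
    · have h1 := (((hasDerivAt_id w).const_sub (x + y + z)).add hsd).div_const 2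
      have h2 := h1
      change HasDerivAt (fun w => (x + y + z - w + √(D w)) / 2) _ w at h2
      rw [← hX] at h2
      refine h2.congr_deriv ?_
      rw [hY]
      field_simp
      ring
    · have h1 := (((hasDerivAt_id w).const_sub (x + y + z)).sub hsd).div_const 2
      have h2 := h1
      change HasDerivAt (fun w => (x + y + z - w - √(D w)) / 2) _ w at h2
      rw [← hY] at h2
      refine h2.congr_deriv ?_
      rw [hX]
      field_simp
      ring
  -- The derivative is positive because `log` has a larger chord slope on `[w, Y]` than on `[Y, X]`;
  -- so decreasing `w` lowers the entropy.
  have hmono : StrictMonoOn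
      (fun w => Real.negMulLog (X w) + Real.negMulLog (Y w) + Real.negMulLog w)
      (Set.Icc (z - ε / 2) z) := by
    apply strictMonoOn_of_deriv_pos (convex_Icc _ _)
    · have h1 := Real.continuous_negMulLog
      apply Continuous.continuousOn
      rw [hX, hY]
      fun_prop
    · intro w hw
      rw [interior_Icc] at hw
      obtain ⟨h1, h2⟩ := hder w hw
      have hw0 := (hgood w ⟨hw.1.le, hw.2.le⟩).2
      have hwY := hYw w ⟨hw.1.le, hw.2⟩
      have hYX := hXY w ⟨hw.1.le, hw.2.le⟩
      have hD := (((Real.hasDerivAt_negMulLog (by linarith : X w ≠ 0)).comp w h1).add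
        ((Real.hasDerivAt_negMulLog (by linarith : Y w ≠ 0)).comp w h2)).add
        (Real.hasDerivAt_negMulLog hw0.ne')
      have hD' : deriv
          (fun w => Real.negMulLog (X w) + Real.negMulLog (Y w) + Real.negMulLog w) w = _ :=
        hD.deriv
      rw [hD']
      have hsl := strictConcaveOn_log_Ioi.slope_anti_adjacent (Set.mem_Ioi.2 hw0)
        (Set.mem_Ioi.2 (by linarith : 0 < X w)) hwY hYX
      generalize Y w = b at *
      generalize X w = a at *
      rw [div_lt_div_iff₀ (by linarith) (by linarith)] at hsl
      have hba : b - a < 0 := by linarith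
      have : (-Real.log a - 1) * ((w - b) / (b - a)) + (-Real.log b - 1) * ((a - w) / (b - a))
          + (-Real.log w - 1) = ((Real.log b - Real.log w) * (a - b) -
            (Real.log a - Real.log b) * (b - w)) / (a - b) := by
        have h3 : b - a ≠ 0 := hba.ne
        have h4 : a - b ≠ 0 := by linarith
        field_simp
        ring
      rw [this]
      apply div_pos <;> linarith
  have hmem : z - ε / 2 ∈ Set.Icc (z - ε / 2) z := ⟨le_rfl, by linarith⟩
  have hlt := hmono hmem ⟨by linarith, le_rfl⟩ (by linarith : z - ε / 2 < z)
  simp only [hXz, hYz] at hlt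
  have hY0 : 0 ≤ Y (z - ε / 2) :=
    (hgood _ hmem).2.le.trans (hYw _ ⟨le_rfl, by linarith⟩).le
  refine ⟨X (z - ε / 2), Y (z - ε / 2), z - ε / 2, by linarith [hXY _ hmem], hY0,
    (hgood _ hmem).2.le, ?_, ?_, hlt⟩
  · rw [hX, hY]; ring
  · have := Real.sq_sqrt (hgood _ hmem).1.le
    generalize z - ε / 2 = w at *
    rw [hX, hY]
    simp only
    have h3 : D w = 2 * (x ^ 2 + y ^ 2 + z ^ 2 - w ^ 2) - (x + y + z - w) ^ 2 := by rw [hD]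
    nlinarith

/-! ### Greedy filling of abstract arcs -/

/-- Any partial filling of finitely many arcs costs at least as much as filling them in order:
there is a greedy filling of the same total length that is no more expensive. -/
lemma exists_greedy_filling {g : ℕ → ℝ → ℝ} {l : ℕ → ℝ} (hl : ∀ j, 0 ≤ l j)
    (hg0 : ∀ j, g j 0 = 0)
    (hle : ∀ i j, i ≤ j → ∀ s ∈ Set.Icc 0 (l i), ∀ t ∈ Set.Icc 0 (l j), s + t ≤ l i →
      g i (s + t) ≤ g i s + g j t)
    (hge : ∀ i j, i ≤ j → ∀ s ∈ Set.Icc 0 (l i), ∀ t ∈ Set.Icc 0 (l j), l i ≤ s + t →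
      g i (l i) + g j (s + t - l i) ≤ g i s + g j t)
    {s : ℕ → ℝ} (hs : ∀ j, s j ∈ Set.Icc 0 (l j)) (N : ℕ) :
    ∃ n r, n ≤ N ∧ (n = N → r = 0) ∧ r ∈ Set.Icc 0 (l n) ∧
      ∑ j ∈ Finset.range N, s j = ∑ j ∈ Finset.range n, l j + r ∧
      ∑ j ∈ Finset.range n, g j (l j) + g n r ≤ ∑ j ∈ Finset.range N, g j (s j) := by
  -- Inserts a piece `t` lying on arc `N` into a greedy filling that stops on arc `n`: either it
  -- fits there, or arc `n` is completed and the overflow, still at most `l N`, is carried on. If `n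
  -- = N`, the condition `r = 0` keeps arc `N` free for `t`.
  have key : ∀ N d n, n + d = N → ∀ r ∈ Set.Icc 0 (l n), (n = N → r = 0) →
      ∀ t ∈ Set.Icc 0 (l N), ∃ n' r', n' ≤ N ∧ r' ∈ Set.Icc 0 (l n') ∧
        ∑ j ∈ Finset.range n, l j + r + t = ∑ j ∈ Finset.range n', l j + r' ∧
        ∑ j ∈ Finset.range n', g j (l j) + g n' r' ≤
          ∑ j ∈ Finset.range n, g j (l j) + g n r + g N t := by
    intro N d
    induction d with
    | zero =>
      intro n hn r hr hr0 t ht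
      obtain rfl : n = N := by omega
      exact ⟨n, t, le_rfl, ht, by rw [hr0 rfl]; ring, by rw [hr0 rfl, hg0]; linarith⟩
    | succ d ih =>
      intro n hn r hr hr0 t ht
      rcases le_total (r + t) (l n) with h | h
      · exact ⟨n, r + t, by omega, ⟨add_nonneg hr.1 ht.1, h⟩, by ring,
          by linarith [hle n N (by omega) r hr t ht h]⟩
      · have h2 := hge n N (by omega) r hr t ht h
        obtain ⟨n', r', h1', h2', h3', h4'⟩ := ih (n + 1) (by omega) 0 ⟨le_rfl, hl _⟩
          (fun _ => rfl) (r + t - l n) ⟨by linarith, by linarith [hr.2, ht.2]⟩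
        rw [Finset.sum_range_succ] at h3' h4'
        rw [hg0] at h4'
        exact ⟨n', r', h1', h2', by linarith, by linarith⟩
  induction N with
  | zero => exact ⟨0, 0, le_rfl, fun _ => rfl, ⟨le_rfl, hl 0⟩, by simp, by simp [hg0]⟩
  | succ N ih =>
    obtain ⟨n, r, h1, h2, h3, h4, h5⟩ := ih
    obtain ⟨n', r', h1', h2', h3', h4'⟩ := key N (N - n) n (by omega) r h3 h2 (s N) (hs N)
    refine ⟨n', r', by omega, by omega, h2', ?_, ?_⟩
    · rw [Finset.sum_range_succ, h4, h3']
    · rw [Finset.sum_range_succ]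
      linarith

/-- The cost of a greedy filling is monotone in the total length. -/
lemma greedy_cost_mono {g : ℕ → ℝ → ℝ} {l : ℕ → ℝ} (hl : ∀ j, 0 < l j)
    (hg0 : ∀ j, g j 0 = 0) (hg : ∀ j, MonotoneOn (g j) (Set.Icc 0 (l j)))
    {n n' : ℕ} {r r' : ℝ} (hr : r ∈ Set.Icc 0 (l n)) (hr' : r' ∈ Set.Icc 0 (l n'))
    (h : ∑ j ∈ Finset.range n', l j + r' ≤ ∑ j ∈ Finset.range n, l j + r) :
    ∑ j ∈ Finset.range n', g j (l j) + g n' r' ≤ ∑ j ∈ Finset.range n, g j (l j) + g n r := by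
  have hnn : ∀ j, ∀ t ∈ Set.Icc 0 (l j), 0 ≤ g j t := fun j t ht => by
    rw [← hg0 j]; exact hg j ⟨le_rfl, (hl j).le⟩ ht ht.1
  have hm : ∀ {a b : ℕ}, a ≤ b → ∀ {f : ℕ → ℝ}, (∀ j, 0 ≤ f j) →
      ∑ j ∈ Finset.range a, f j ≤ ∑ j ∈ Finset.range b, f j := fun hab f hf =>
    Finset.sum_le_sum_of_subset_of_nonneg (Finset.range_mono hab) (fun j _ _ => hf j)
  rcases lt_trichotomy n' n with hn | rfl | hn
  · have h1 := hm (f := fun j => g j (l j)) (Nat.succ_le_of_lt hn)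
      (fun j => hnn j _ ⟨(hl j).le, le_rfl⟩)
    rw [Nat.succ_eq_add_one, Finset.sum_range_succ] at h1
    linarith [hg n' hr' ⟨(hl n').le, le_rfl⟩ hr'.2, hnn n r hr]
  · have := hg n' hr' hr (by linarith)
    linarith
  -- Positive lengths leave one possibility: the same filling written in two ways, with arc `n` full
  -- or arc `n + 1` empty.
  · obtain rfl | hn := (Nat.succ_le_of_lt hn).eq_or_lt
    · rw [Nat.succ_eq_add_one, Finset.sum_range_succ] at h ⊢
      have e1 : r = l n := by linarith [hr.2, hr'.1]
      have e2 : r' = 0 := by linarith [hr.2, hr'.1]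
      rw [e1, e2, hg0]
      linarith
    · have h1 := hm (f := l) (Nat.succ_le_of_lt hn) (fun j => (hl j).le)
      rw [Finset.sum_range_succ, Finset.sum_range_succ] at h1
      linarith [hl (n + 1), hr.2, hr'.1]

/-! ### Minimal entropy at given collision probability -/

/-- The point `t` of the `K`-th arc at which the small probability is `q`. -/
lemma arc_point {K q : ℝ} (hK : 0 < K) (hq : 0 ≤ q) (hq' : (K + 1) * q ≤ 1) :
    (2 * q - (K + 1) * q ^ 2) / K ∈ Set.Icc 0 (arcLength K) ∧
      tailProb K ((2 * q - (K + 1) * q ^ 2) / K) = q ∧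
      q ^ 2 + K * ((1 - q) / K) ^ 2 = 1 / K - (2 * q - (K + 1) * q ^ 2) / K := by
  have e : 1 - K * (K + 1) * ((2 * q - (K + 1) * q ^ 2) / K) = (1 - (K + 1) * q) ^ 2 := by
    field_simp
    ring
  refine ⟨⟨?_, ?_⟩, ?_, ?_⟩
  · apply div_nonneg _ hK.le
    nlinarith
  · rw [le_arcLength_iff hK]
    nlinarith [sq_nonneg (1 - (K + 1) * q)]
  · unfold tailProb
    rw [e, Real.sqrt_sq (by linarith)]
    field_simp
    ring
  · field_simp
    ring

lemma tailProb_spec {K t : ℝ} (hK : 0 < K) (ht : t ∈ Set.Icc 0 (arcLength K)) :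
    0 ≤ tailProb K t ∧ (K + 1) * tailProb K t ≤ 1 ∧
      (2 * tailProb K t - (K + 1) * tailProb K t ^ 2) / K = t := by
  have h1 := (le_arcLength_iff hK).1 ht.2
  have h0 : 0 ≤ K * (K + 1) * t := mul_nonneg (by positivity) ht.1
  have hu : √(1 - K * (K + 1) * t) ≤ 1 := by
    exact Real.sqrt_le_one.2 (by linarith)
  have hu0 := Real.sqrt_nonneg (1 - K * (K + 1) * t)
  have hsq := Real.sq_sqrt (sub_nonneg.2 h1)
  unfold tailProb
  generalize √(1 - K * (K + 1) * t) = u at *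
  refine ⟨div_nonneg (by linarith) (by linarith), ?_, ?_⟩
  · rw [mul_div_cancel₀ _ (by linarith)]; linarith
  · have : t = (1 - u ^ 2) / (K * (K + 1)) := by rw [hsq]; field_simp; ring
    rw [this]
    field_simp
    ring

lemma sum_replace_three {α : Type*} [Fintype α] [DecidableEq α] (f : ℝ → ℝ) (P : α → ℝ)
    {i j k : α} (hij : i ≠ j) (hik : i ≠ k) (hjk : j ≠ k) (x y z : ℝ) :
    ∑ w, f (if w = i then x else if w = j then y else if w = k then z else P w) =
      ∑ w, f (P w) + (f x + f y + f z - (f (P i) + f (P j) + f (P k))) := by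
  rw [← sub_eq_iff_eq_add', ← Finset.sum_sub_distrib]
  rw [← Finset.sum_subset (Finset.subset_univ {i, j, k})]
  · rw [Finset.sum_insert (by simp [hij, hik]), Finset.sum_insert (by simp [hjk]),
      Finset.sum_singleton]
    simp [hij.symm, hik.symm, hjk.symm]
    ring
  · intro w _ hw
    simp only [Finset.mem_insert, Finset.mem_singleton, not_or] at hw
    simp [hw.1, hw.2.1, hw.2.2]

lemma exists_min_entropy {α : Type*} [Fintype α] {P : α → ℝ} (hP : P ∈ stdSimplex ℝ α) :
    ∃ Q ∈ stdSimplex ℝ α, collisionProb Q = collisionProb P ∧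
      ∀ R ∈ stdSimplex ℝ α, collisionProb R = collisionProb P →
        shannonEntropy Q ≤ shannonEntropy R := by
  have hc : Continuous (collisionProb : (α → ℝ) → ℝ) := by unfold collisionProb; fun_prop
  have hH : Continuous (shannonEntropy : (α → ℝ) → ℝ) := by
    unfold shannonEntropy
    have := Real.continuous_negMulLog
    fun_prop
  have hcomp : IsCompact (stdSimplex ℝ α ∩ {Q | collisionProb Q = collisionProb P}) :=
    (isCompact_stdSimplex ℝ α).inter_right (isClosed_eq hc continuous_const)
  obtain ⟨Q, hQ, hmin⟩ := hcomp.exists_isMinOn ⟨P, hP, rfl⟩ hH.continuousOn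
  exact ⟨Q, hQ.1, hQ.2, fun R hR hR' => hmin ⟨hR, hR'⟩⟩

/-- Every distribution has at least the entropy of the point on the piecewise concave curve
with the same collision probability. -/
lemma exists_arc_le_entropy {α : Type*} [Fintype α] {P : α → ℝ} (hP : P ∈ stdSimplex ℝ α) :
    ∃ (κ : ℕ) (t : ℝ), t ∈ Set.Icc 0 (arcLength (κ + 1)) ∧
      collisionProb P = 1 / ((κ : ℝ) + 1) - t ∧
      Real.log (κ + 1) + excess (κ + 1) t ≤ shannonEntropy P := by
  classical
  obtain ⟨Q, hQ, hQP, hmin⟩ := exists_min_entropy hP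
  -- A minimiser admits no perturbation of three positive probabilities, so the upper two of any
  -- three coincide.
  have htriple : ∀ i j k, i ≠ j → j ≠ k → 0 < Q k → Q k ≤ Q j → Q j ≤ Q i → Q j = Q i := by
    intro i j k hij hjk hk hkj hji
    by_contra hne
    have hlt : Q j < Q i := lt_of_le_of_ne hji hne
    have hik : i ≠ k := by rintro rfl; linarith
    obtain ⟨x, y, z, hx, hy, hz, hs, hs2, hH⟩ := exists_lower_entropy_triple hk hkj hlt
    have hR := sum_replace_three (fun v => v) Q hij hik hjk x y z
    have hR2 := sum_replace_three (fun v => v ^ 2) Q hij hik hjk x y z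
    have hRH := sum_replace_three Real.negMulLog Q hij hik hjk x y z
    have := hmin (fun w => if w = i then x else if w = j then y else if w = k then z else Q w)
      ⟨fun w => by dsimp only; split_ifs <;> first | assumption | exact hQ.1 w,
        by rw [hR, hQ.2]; linarith⟩
      (by rw [← hQP]; unfold collisionProb; linarith)
    unfold shannonEntropy at this
    linarith
  obtain ⟨S, hS⟩ : ∃ S : Finset α, S = Finset.univ.filter (fun i => 0 < Q i) := ⟨_, rfl⟩
  have hmem : ∀ i, i ∈ S ↔ 0 < Q i := by simp [hS]
  have hsum : ∀ f : ℝ → ℝ, f 0 = 0 → ∑ i, f (Q i) = ∑ i ∈ S, f (Q i) := by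
    intro f hf
    symm
    apply Finset.sum_subset (Finset.subset_univ _)
    intro i _ hi
    rw [hmem, not_lt] at hi
    rw [le_antisymm hi (hQ.1 i), hf]
  have hSne : S.Nonempty := by
    by_contra h
    rw [Finset.not_nonempty_iff_eq_empty] at h
    have h1 := hsum (fun v => v) rfl
    rw [h, Finset.sum_empty, hQ.2] at h1
    exact one_ne_zero h1
  obtain ⟨m, hm, hmle⟩ := S.exists_min_image Q hSne
  obtain ⟨i, hi, hile⟩ := S.exists_max_image Q hSne
  have hothers : ∀ j ∈ S.erase m, Q j = Q i := by
    intro j hj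
    rw [Finset.mem_erase] at hj
    rcases eq_or_ne i j with rfl | hij
    · rfl
    · exact htriple i j m hij hj.1 ((hmem m).1 hm) (hmle j hj.2) (hile j hj.2)
  have hsum' : ∀ f : ℝ → ℝ, f 0 = 0 →
      ∑ i, f (Q i) = f (Q m) + ((S.erase m).card : ℝ) * f (Q i) := by
    intro f hf
    rw [hsum f hf, ← Finset.add_sum_erase S _ hm,
      Finset.sum_congr rfl (fun j hj => by rw [hothers j hj]), Finset.sum_const, nsmul_eq_mul]
  have h1 : ∑ i, Q i = Q m + ((S.erase m).card : ℝ) * Q i := hsum' (fun v => v) rfl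
  have h2 : collisionProb Q = Q m ^ 2 + ((S.erase m).card : ℝ) * Q i ^ 2 :=
    hsum' (fun v => v ^ 2) (by simp)
  have h3 : shannonEntropy Q =
      Real.negMulLog (Q m) + ((S.erase m).card : ℝ) * Real.negMulLog (Q i) :=
    hsum' _ Real.negMulLog_zero
  rw [hQ.2] at h1
  have hle := hmin P hP rfl
  have hmi := hile m hm
  have hm0 := (hmem m).1 hm
  rw [← hQP]
  generalize hcard : (S.erase m).card = c at *
  generalize Q m = q at *
  generalize Q i = p at *
  -- `c` counts the support without its minimum. For `c = 0` this is a point mass, the start of the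
  -- first arc; otherwise `c` is the index of the arc.
  cases c with
  | zero =>
    have : q = 1 := by simpa using h1.symm
    subst this
    refine ⟨0, 0, ⟨le_rfl, (arcLength_pos (by positivity)).le⟩, by simp [h2], ?_⟩
    simp [excess_zero]
    simp at h3
    linarith
  | succ κ =>
    push_cast at h1 h2 h3
    have hK : (0 : ℝ) < κ + 1 := by positivity
    have hp : p = (1 - q) / ((κ : ℝ) + 1) := by field_simp; linarith
    obtain ⟨ha, hb, hc⟩ := arc_point hK hm0.le (by nlinarith)
    refine ⟨κ, _, ha, ?_, ?_⟩
    · rw [h2, hp, hc]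
    · rw [excess, hb, binEntropy_tail_eq hK, ← hp, ← h3]
      exact hle

/-- Every point of the curve is attained on a sufficiently large set. -/
lemma exists_distribution_of_arc {α : Type*} [Fintype α] {K : ℕ} {t : ℝ} (hK : 0 < K)
    (ht : t ∈ Set.Icc 0 (arcLength K)) (hcard : K ≤ Fintype.card α)
    (hcard' : K + 1 ≤ Fintype.card α ∨ t = 0) :
    ∃ P ∈ stdSimplex ℝ α, collisionProb P = 1 / (K : ℝ) - t ∧
      shannonEntropy P = Real.log K + excess K t := by
  have hK0 : (0 : ℝ) < K := by exact_mod_cast hK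
  obtain ⟨hq0, hq1, hqt⟩ := tailProb_spec hK0 ht
  obtain ⟨-, -, hic⟩ := arc_point hK0 hq0 hq1
  rw [hqt] at hic
  have hent := binEntropy_tail_eq (q := tailProb K t) hK0
  -- At `t = 0` the small atom vanishes and `K` points suffice, as is needed when `M / ktot` is an
  -- integer.
  have htail : K + 1 ≤ Fintype.card α ∨ tailProb K t = 0 :=
    hcard'.imp id (fun h => by rw [h, tailProb_zero])
  change Real.log K + excess K t = _ at hent
  generalize tailProb K t = q at *
  obtain ⟨Q, hQ⟩ : ∃ Q : ℕ → ℝ, Q = fun n =>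
    if n < K then (1 - q) / K else if n = K then q else 0 := ⟨_, rfl⟩
  let e := Fintype.equivFin α
  have hsum : ∀ f : ℝ → ℝ, f 0 = 0 → ∑ x, f (Q (e x)) = f q + K * f ((1 - q) / K) := by
    intro f hf
    rw [e.sum_comp (fun i => f (Q i)), ← Finset.sum_range (fun n => f (Q n))]
    have h1 : ∑ n ∈ Finset.range K, f (Q n) = K * f ((1 - q) / K) := by
      rw [Finset.sum_congr rfl (g := fun _ => f ((1 - q) / K)), Finset.sum_const,
        Finset.card_range, nsmul_eq_mul]
      intro n hn
      simp [hQ, Finset.mem_range.1 hn]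
    rcases htail with h | h
    · rw [← Finset.sum_subset (Finset.range_mono h), Finset.sum_range_succ, h1]
      · simp [hQ, add_comm]
      · intro n _ hn
        simp only [Finset.mem_range, not_lt] at hn
        simp [hQ, show ¬ n < K by omega, show n ≠ K by omega, hf]
    · rw [← Finset.sum_subset (Finset.range_mono hcard), h1, h, hf, zero_add]
      intro n _ hn
      simp only [Finset.mem_range, not_lt] at hn
      simp [hQ, show ¬ n < K by omega, h, hf]
  refine ⟨fun x => Q (e x), ⟨fun x => ?_, ?_⟩, ?_, ?_⟩
  · have : 0 ≤ (1 - q) / K := div_nonneg (by nlinarith) hK0.le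
    simp only [hQ]
    split_ifs <;> first | assumption | exact le_rfl
  · rw [hsum (fun v => v) rfl]
    field_simp
    ring
  · exact (hsum (fun v => v ^ 2) (by simp)).trans hic
  · exact (hsum _ Real.negMulLog_zero).trans hent.symm

/-! ### The function `Htilde` in arc coordinates -/

lemma arcIndex_eq {K : ℕ} {t : ℝ} (hK : 0 < K) (ht : 0 ≤ t) (ht' : t < arcLength K) :
    arcIndex (1 / (K : ℝ) - t) = K := by
  have hK0 : (0 : ℝ) < K := by exact_mod_cast hK
  have h1 : 1 / (K : ℝ) - arcLength K = 1 / (K + 1) := by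
    unfold arcLength; field_simp; ring
  have h2 : (0 : ℝ) < 1 / (K + 1) := by positivity
  have hpos : 0 < 1 / (K : ℝ) - t := by linarith
  unfold arcIndex
  rw [Nat.floor_eq_iff (by positivity)]
  constructor
  · rw [le_one_div hK0 hpos]
    linarith
  · rw [one_div_lt hpos (by positivity)]
    linarith

/-- The right end of the range of `t` is excluded because there `⌊1/k⌋` jumps to `K + 1`. -/
lemma Htilde_eq_of_lt {K : ℕ} {t : ℝ} (hK : 0 < K) (ht : 0 ≤ t) (ht' : t < arcLength K) :
    Htilde (1 / (K : ℝ) - t) = Real.log K + excess K t := by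
  have hK0 : (0 : ℝ) < K := by exact_mod_cast hK
  have e : (K : ℝ) * (1 / (K : ℝ) - t + K * (1 / (K : ℝ) - t) - 1) = 1 - K * (K + 1) * t := by
    field_simp
    ring
  have hs : smallProb (1 / (K : ℝ) - t) = tailProb K t := by
    unfold smallProb tailProb
    rw [arcIndex_eq hK ht ht', e]
    field_simp
    ring
  have hb : bigProb (1 / (K : ℝ) - t) = (1 - tailProb K t) / K := by
    unfold bigProb tailProb
    rw [arcIndex_eq hK ht ht', e]
    field_simp
    ring
  have := binEntropy_tail_eq (q := tailProb K t) hK0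
  unfold Htilde excess
  rw [this, hs, hb, arcIndex_eq hK ht ht']
  simp only [Real.negMulLog]
  ring

lemma Htilde_one_div {K : ℕ} (hK : 0 < K) : Htilde (1 / (K : ℝ)) = Real.log K := by
  have := Htilde_eq_of_lt hK le_rfl (arcLength_pos (by exact_mod_cast hK))
  simpa [excess_zero] using this

/-! ### Exchange inequalities -/

/-- Concavity and `excess a 0 = 0` make `excess a` subadditive; then `excess a t ≤ excess b t`. -/
lemma excess_add_le {a b s t : ℝ} (ha : 1 ≤ a) (hab : a ≤ b) (hs : 0 ≤ s)
    (ht : t ∈ Set.Icc 0 (arcLength b)) (hst : s + t ≤ arcLength a) :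
    excess a (s + t) ≤ excess a s + excess b t := by
  have ha0 : 0 < a := by linarith
  have h1 := excess_mono_index ha0 hab ht.1 ht.2
  rcases ht.1.eq_or_lt with h0 | h0
  · simp [← h0, excess_zero]
  rcases hs.eq_or_lt with rfl | h0s
  · simpa [excess_zero] using h1
  have hc := excess_concaveOn ha
  have hmem : s + t ∈ Set.Icc 0 (arcLength a) := ⟨by linarith, hst⟩
  have hst0 : 0 < s + t := by linarith
  have key : ∀ u, 0 ≤ u → u ≤ s + t → u / (s + t) * excess a (s + t) ≤ excess a u := by
    intro u hu hus
    have := hc.2 ⟨le_rfl, (arcLength_pos ha0).le⟩ hmem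
      (show 0 ≤ 1 - u / (s + t) by rw [sub_nonneg, div_le_one hst0]; exact hus)
      (show 0 ≤ u / (s + t) by positivity) (by ring)
    simp only [excess_zero, smul_eq_mul, mul_zero, zero_add, div_mul_cancel₀ _ hst0.ne'] at this
    exact this
  have k1 := key s hs (by linarith [ht.1])
  have k2 := key t ht.1 (by linarith)
  have : s / (s + t) * excess a (s + t) + t / (s + t) * excess a (s + t) = excess a (s + t) := by
    field_simp
  linarith

/-- Completing arc `a` costs its last stretch, of length `r`. That is at most the cost of the last
stretch of length `r` on arc `b`, hence, by concavity, at most what is saved by going back from `t`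
to `t - r`. -/
lemma excess_full_add_le {a b s t : ℝ} (ha : 1 ≤ a) (hab : a ≤ b) (hs : s ≤ arcLength a)
    (ht : t ∈ Set.Icc 0 (arcLength b)) (hst : arcLength a ≤ s + t) :
    excess a (arcLength a) + excess b (s + t - arcLength a) ≤ excess a s + excess b t := by
  have ha0 : 0 < a := by linarith
  have hb0 : 0 < b := by linarith
  obtain ⟨r, hr⟩ : ∃ r, r = arcLength a - s := ⟨_, rfl⟩
  have hdrop := excess_drop_mono (r := r) ha0 hab (by linarith) (by linarith [ht.2])
  have e1 : arcLength a - r = s := by linarith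
  have e2 : s + t - arcLength a = t - r := by linarith
  rw [e1] at hdrop
  rw [e2]
  rcases ht.2.eq_or_lt with h | h
  · rw [← h] at hdrop
    linarith
  obtain ⟨L, hL⟩ : ∃ L, L = arcLength b := ⟨_, rfl⟩
  rw [← hL] at hdrop h
  have hc := (excess_concaveOn (ha.trans hab))
  rw [← hL] at hc
  have h0 : t - r ∈ Set.Icc 0 L := ⟨by linarith, by linarith [ht.2]⟩
  have h1 : L ∈ Set.Icc 0 L := ⟨by linarith [ht.1], le_rfl⟩
  obtain ⟨d, hd⟩ : ∃ d, d = L - (t - r) := ⟨_, rfl⟩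
  have hd0 : 0 < d := by linarith
  -- Both `t` and `L - r` are convex combinations of `t - r` and `L`, with the weights swapped; the
  -- two inequalities are added at the end.
  have c1 := hc.2 h0 h1 (show 0 ≤ (L - t) / d from div_nonneg (by linarith) hd0.le)
    (show 0 ≤ r / d from div_nonneg (by linarith) hd0.le) (by rw [hd]; rw [hd] at hd0; field_simp; ring)
  have c2 := hc.2 h0 h1 (show 0 ≤ r / d from div_nonneg (by linarith) hd0.le)
    (show 0 ≤ (L - t) / d from div_nonneg (by linarith) hd0.le) (by rw [hd]; rw [hd] at hd0; field_simp; ring)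
  simp only [smul_eq_mul] at c1 c2
  have e3 : (L - t) / d * (t - r) + r / d * L = t := by
    field_simp; rw [hd]; ring
  have e4 : r / d * (t - r) + (L - t) / d * L = L - r := by
    field_simp; rw [hd]; ring
  rw [e3] at c1
  rw [e4] at c2
  have e5 : (L - t) / d * excess b (t - r) + r / d * excess b (t - r) = excess b (t - r) := by
    field_simp; rw [hd]; ring
  have e6 : (L - t) / d * excess b L + r / d * excess b L = excess b L := by
    field_simp; rw [hd]; ring
  linarith

/-! ### Assembling the arcs of all distributions -/

/-- Filling the arcs before `κ` completely and the arc `κ` up to `t`. -/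
noncomputable def fill (l : ℕ → ℝ) (κ : ℕ) (t : ℝ) (a : ℕ) : ℝ :=
  if a < κ then l a else if a = κ then t else 0

lemma fill_mem {l : ℕ → ℝ} (hl : ∀ a, 0 ≤ l a) {κ : ℕ} {t : ℝ} (ht : t ∈ Set.Icc 0 (l κ))
    (a : ℕ) : fill l κ t a ∈ Set.Icc 0 (l a) := by
  unfold fill
  split_ifs with h1 h2
  · exact ⟨hl a, le_rfl⟩
  · rwa [h2]
  · exact ⟨le_rfl, hl a⟩

lemma sum_fill (l : ℕ → ℝ) (κ : ℕ) (t : ℝ) {G : ℕ → ℝ → ℝ} (hG : ∀ a, G a 0 = 0) {A : ℕ}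
    (hA : κ < A) :
    ∑ a ∈ Finset.range A, G a (fill l κ t a) = ∑ a ∈ Finset.range κ, G a (l a) + G κ t := by
  rw [← Finset.sum_subset (Finset.range_mono hA), Nat.succ_eq_add_one, Finset.sum_range_succ]
  · congr 1
    · apply Finset.sum_congr rfl
      intro a ha
      simp [fill, Finset.mem_range.1 ha]
    · simp [fill]
  · intro a _ ha
    simp only [Finset.mem_range, not_lt] at ha
    simp [fill, show ¬ a < κ by omega, show a ≠ κ by omega, hG]

/-- The copies of arcs are listed round by round: `j` stands for arc `j / M` of distribution `j %
M`. -/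
lemma sum_range_mul_eq {M : ℕ} (hM : 0 < M) (F : ℕ → Fin M → ℝ) (A : ℕ) :
    ∑ j ∈ Finset.range (A * M), F (j / M) ⟨j % M, Nat.mod_lt j hM⟩ =
      ∑ i, ∑ a ∈ Finset.range A, F a i := by
  induction A with
  | zero => simp
  | succ A ih =>
    simp only [Finset.sum_range_succ]
    rw [Nat.succ_mul, Finset.sum_range_add, ih, Finset.sum_add_distrib,
      Finset.sum_range (n := M)]
    congr 1
    apply Finset.sum_congr rfl
    intro i _
    have h1 : (A * M + (i : ℕ)) / M = A := by
      rw [mul_comm, Nat.mul_add_div hM, Nat.div_eq_of_lt i.2, add_zero]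
    have h2 : (⟨(A * M + (i : ℕ)) % M, Nat.mod_lt _ hM⟩ : Fin M) = i := by
      ext
      simp [Nat.mod_eq_of_lt i.2]
    rw [h1, h2]

lemma sum_arcLength (κ : ℕ) :
    ∑ a ∈ Finset.range κ, arcLength ((a : ℝ) + 1) = 1 - 1 / ((κ : ℝ) + 1) := by
  induction κ with
  | zero => simp
  | succ κ ih =>
    rw [Finset.sum_range_succ, ih]
    unfold arcLength
    push_cast
    field_simp
    ring

lemma sum_excess_arcLength (κ : ℕ) :
    ∑ a ∈ Finset.range κ, excess ((a : ℝ) + 1) (arcLength ((a : ℝ) + 1)) =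
      Real.log ((κ : ℝ) + 1) := by
  induction κ with
  | zero => simp
  | succ κ ih =>
    rw [Finset.sum_range_succ, ih, excess_arcLength (by positivity)]
    push_cast
    ring

/-- The sum of the values of finitely many points on the piecewise concave curve is at least the
value at the greedy configuration. -/
lemma greedy_le_sum {M : ℕ} (hM : 0 < M) (κ : Fin M → ℕ) (t : Fin M → ℝ)
    (ht : ∀ i, t i ∈ Set.Icc 0 (arcLength ((κ i : ℝ) + 1))) {κ₀ Φ : ℕ} {r : ℝ} (hΦ : Φ < M)
    (hr : r ∈ Set.Icc 0 (arcLength ((κ₀ : ℝ) + 1)))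
    (h : ∑ i, (1 / ((κ i : ℝ) + 1) - t i) ≤
      M * (1 / ((κ₀ : ℝ) + 1)) - (Φ * arcLength ((κ₀ : ℝ) + 1) + r)) :
    M * Real.log ((κ₀ : ℝ) + 1) +
        (Φ * excess ((κ₀ : ℝ) + 1) (arcLength ((κ₀ : ℝ) + 1)) + excess ((κ₀ : ℝ) + 1) r) ≤
      ∑ i, (Real.log ((κ i : ℝ) + 1) + excess ((κ i : ℝ) + 1) (t i)) := by
  obtain ⟨l, hl⟩ : ∃ l : ℕ → ℝ, l = fun a : ℕ => arcLength ((a : ℝ) + 1) := ⟨_, rfl⟩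
  obtain ⟨g, hg⟩ : ∃ g : ℕ → ℝ → ℝ, g = fun a : ℕ => excess ((a : ℝ) + 1) := ⟨_, rfl⟩
  have hlpos : ∀ a, 0 < l a := fun a => by rw [hl]; exact arcLength_pos (by positivity)
  have hg0 : ∀ a, g a 0 = 0 := fun a => by rw [hg]; exact excess_zero _
  have hone : ∀ a : ℕ, (1 : ℝ) ≤ (a : ℝ) + 1 := fun a => by
    have : (0 : ℝ) ≤ a := by positivity
    linarith
  have hcast : ∀ {i j : ℕ}, i ≤ j → ((i / M : ℕ) : ℝ) + 1 ≤ ((j / M : ℕ) : ℝ) + 1 :=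
    fun hij => by
      have := Nat.div_le_div_right (c := M) hij
      gcongr
  obtain ⟨s, hs⟩ : ∃ s : ℕ → ℝ, s = fun j =>
    fill l (κ ⟨j % M, Nat.mod_lt j hM⟩) (t ⟨j % M, Nat.mod_lt j hM⟩) (j / M) := ⟨_, rfl⟩
  obtain ⟨A, hA⟩ : ∃ A : ℕ, ∀ i, κ i < A :=
    ⟨∑ i, κ i + 1, fun i => Nat.lt_succ_of_le
      (Finset.single_le_sum (fun _ _ => Nat.zero_le _) (Finset.mem_univ i))⟩
  obtain ⟨n, v, -, -, hv, hsum, hcost⟩ := exists_greedy_filling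
    (g := fun j => g (j / M)) (l := fun j => l (j / M)) (fun j => (hlpos _).le)
    (fun j => hg0 _)
    (by
      intro i j hij s hs t ht hst
      simp only [hg, hl] at hs ht hst ⊢
      exact excess_add_le (hone _) (hcast hij) hs.1 ht hst)
    (by
      intro i j hij s hs t ht hst
      simp only [hg, hl] at hs ht hst ⊢
      exact excess_full_add_le (hone _) (hcast hij) hs.2 ht hst)
    (s := s)
    (by
      intro j
      rw [hs]
      exact fill_mem (fun a => (hlpos a).le) (by rw [hl]; exact ht _) _)
    (A * M)
  have hcostA : ∑ j ∈ Finset.range (A * M), g (j / M) (s j) =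
      ∑ i, (Real.log ((κ i : ℝ) + 1) + excess ((κ i : ℝ) + 1) (t i)) := by
    rw [hs, sum_range_mul_eq hM (fun a i => g a (fill l (κ i) (t i) a))]
    apply Finset.sum_congr rfl
    intro i _
    rw [sum_fill l (κ i) (t i) hg0 (hA i), ← sum_excess_arcLength, hg, hl]
  have hsumA : ∑ j ∈ Finset.range (A * M), s j = ∑ i, (1 - (1 / ((κ i : ℝ) + 1) - t i)) := by
    rw [hs, sum_range_mul_eq hM (fun a i => fill l (κ i) (t i) a)]
    apply Finset.sum_congr rfl
    intro i _
    rw [sum_fill l (κ i) (t i) (G := fun _ v => v) (fun _ => rfl) (hA i), hl, sum_arcLength]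
    ring
  have hdiv : ∀ x < M, (κ₀ * M + x) / M = κ₀ := by
    intro x hx
    rw [mul_comm, Nat.mul_add_div hM, Nat.div_eq_of_lt hx, add_zero]
  -- The greedy target has `κ₀` complete rounds, then `Φ` full arcs of the next round.
  have htarget : ∀ f : ℕ → ℝ, ∑ j ∈ Finset.range (κ₀ * M + Φ), f (j / M) =
      M * ∑ a ∈ Finset.range κ₀, f a + Φ * f κ₀ := by
    intro f
    rw [Finset.sum_range_add, sum_range_mul_eq hM (fun a _ => f a)]
    congr 1
    · simp
    · rw [Finset.sum_congr rfl (g := fun _ => f κ₀)]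
      · simp
      · intro x hx
        rw [hdiv x ((Finset.mem_range.1 hx).trans hΦ)]
  have hmono := greedy_cost_mono (g := fun j => g (j / M)) (l := fun j => l (j / M))
    (fun j => hlpos _) (fun j => hg0 _)
    (fun j => by rw [hg, hl]; exact excess_monotoneOn (by positivity))
    (n := n) (r := v) (n' := κ₀ * M + Φ) (r' := r) hv
    (by rw [hdiv Φ hΦ, hl]; exact hr)
    (by
      rw [← hsum, hsumA, htarget l, Finset.sum_sub_distrib, hl, sum_arcLength]
      simp only [Finset.sum_const, Finset.card_univ, Fintype.card_fin, nsmul_eq_mul, mul_one]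
      linarith)
  rw [htarget (fun a => g a (l a)), hdiv Φ hΦ] at hmono
  rw [hcostA] at hcost
  have e : ∑ a ∈ Finset.range κ₀, g a (l a) = Real.log ((κ₀ : ℝ) + 1) := by
    rw [← sum_excess_arcLength, hg, hl]
  rw [e] at hmono
  simp only [hg, hl] at hmono hcost
  linarith

/-! ### The bound as a greedy cost, and tightness -/

/-- The entropy bound is the value at a greedy configuration. -/
lemma entropyBound_eq {M : ℕ} (hM : 1 ≤ M) {ktot : ℝ} (hpos : 0 < ktot) (hle : ktot ≤ M) :
    ∃ (κ Φ : ℕ) (r : ℝ), Φ < M ∧ r ∈ Set.Icc 0 (arcLength ((κ : ℝ) + 1)) ∧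
      ktot = M * (1 / ((κ : ℝ) + 1)) - (Φ * arcLength ((κ : ℝ) + 1) + r) ∧
      entropyBound M ktot = M * Real.log ((κ : ℝ) + 1) +
        (Φ * excess ((κ : ℝ) + 1) (arcLength ((κ : ℝ) + 1)) + excess ((κ : ℝ) + 1) r) ∧
      κ + 1 ≤ ⌈(M : ℝ) / ktot⌉₊ ∧ (κ + 2 ≤ ⌈(M : ℝ) / ktot⌉₊ ∨ (Φ = 0 ∧ r = 0)) := by
  have hM0 : (0 : ℝ) < M := by exact_mod_cast hM
  have hx1 : 1 ≤ (M : ℝ) / ktot := by rwa [one_le_div hpos]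
  have hf1 : 1 ≤ ⌊(M : ℝ) / ktot⌋₊ := Nat.one_le_floor_iff _ |>.2 hx1
  obtain ⟨κ, hκ⟩ : ∃ κ, ⌊(M : ℝ) / ktot⌋₊ = κ + 1 := ⟨_, (Nat.succ_pred_eq_of_pos hf1).symm⟩
  have hκle : ((κ + 1 : ℕ) : ℝ) ≤ M / ktot := hκ ▸ Nat.floor_le (by positivity)
  have hκlt : (M : ℝ) / ktot < ((κ + 1 : ℕ) : ℝ) + 1 := hκ ▸ Nat.lt_floor_add_one _
  have hcge : κ + 1 ≤ ⌈(M : ℝ) / ktot⌉₊ := hκ ▸ Nat.floor_le_ceil _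
  have hmax : kMax M ktot = 1 / ((κ : ℝ) + 1) := by unfold kMax; rw [hκ]; push_cast; rfl
  have hK : (0 : ℝ) < (κ : ℝ) + 1 := by positivity
  have hlog : Htilde (1 / ((κ : ℝ) + 1)) = Real.log ((κ : ℝ) + 1) := by
    have := Htilde_one_div (K := κ + 1) (by omega)
    push_cast at this
    exact this
  rcases hκle.eq_or_lt with h | h
  · have hceil : ⌈(M : ℝ) / ktot⌉₊ = κ + 1 := by rw [← h, Nat.ceil_natCast]
    have hmin : kMin M ktot = 1 / ((κ : ℝ) + 1) := by unfold kMin; rw [hceil]; push_cast; rfl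
    have hPhi : Phi M ktot = 0 := by unfold Phi; rw [hmin, hmax]; simp
    push_cast at h
    have hk : ktot = M * (1 / ((κ : ℝ) + 1)) := by
      rw [eq_div_iff hpos.ne'] at h
      field_simp
      linarith
    refine ⟨κ, 0, 0, by omega, ⟨le_rfl, (arcLength_pos hK).le⟩, by rw [hk]; simp, ?_, hcge,
      Or.inr ⟨rfl, rfl⟩⟩
    unfold entropyBound
    rw [hPhi, hmin, hmax]
    have e : ktot - ((0 : ℤ) : ℝ) * (1 / ((κ : ℝ) + 1)) -
        ((M : ℝ) - 1 - ((0 : ℤ) : ℝ)) * (1 / ((κ : ℝ) + 1)) = 1 / ((κ : ℝ) + 1) := by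
      rw [hk]; push_cast; ring
    rw [e, hlog, excess_zero]
    push_cast
    ring
  · have hceil : ⌈(M : ℝ) / ktot⌉₊ = κ + 2 := by
      rw [Nat.ceil_eq_iff (by omega)]
      constructor
      · simpa using h
      · push_cast at hκlt ⊢; linarith
    have hmin : kMin M ktot = 1 / ((κ : ℝ) + 1 + 1) := by
      unfold kMin; rw [hceil]; push_cast; ring
    have hlen : 1 / ((κ : ℝ) + 1) - 1 / ((κ : ℝ) + 1 + 1) = arcLength ((κ : ℝ) + 1) := by
      unfold arcLength; field_simp; ring
    have hl := arcLength_pos hK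
    -- `y` is the deficit below `M * kMax` in units of the arc length: its integer part is `Φ`, its
    -- fractional part gives `r`.
    obtain ⟨y, hy⟩ : ∃ y, y = (M * (1 / ((κ : ℝ) + 1)) - ktot) / arcLength ((κ : ℝ) + 1) :=
      ⟨_, rfl⟩
    have hquot : (ktot - (M : ℝ) * kMax M ktot) / (kMin M ktot - kMax M ktot) = y := by
      rw [hmin, hmax, hy, ← hlen, ← neg_div_neg_eq]
      congr 1 <;> ring
    push_cast at h hκlt
    rw [lt_div_iff₀ hpos] at h
    rw [div_lt_iff₀ hpos] at hκlt
    have hy0 : 0 ≤ y := by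
      rw [hy]
      apply div_nonneg _ hl.le
      rw [sub_nonneg, mul_one_div, le_div_iff₀ hK]
      linarith
    have hyM : y < M := by
      rw [hy, div_lt_iff₀ hl, ← hlen]
      have : M * (1 / ((κ : ℝ) + 1 + 1)) < ktot := by
        rw [mul_one_div, div_lt_iff₀ (by positivity)]
        linarith
      linarith
    have hPhi : Phi M ktot = ((⌊y⌋₊ : ℕ) : ℤ) := by
      unfold Phi
      rw [if_neg, hquot, Int.natCast_floor_eq_floor hy0]
      rw [hmin, hmax]
      intro he
      linarith
    have hfl : (⌊y⌋₊ : ℝ) ≤ y := Nat.floor_le hy0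
    have hfl' : y < (⌊y⌋₊ : ℝ) + 1 := Nat.lt_floor_add_one y
    have hyl : y * arcLength ((κ : ℝ) + 1) = M * (1 / ((κ : ℝ) + 1)) - ktot := by
      rw [hy, div_mul_cancel₀ _ hl.ne']
    have hΦM : ⌊y⌋₊ < M := (Nat.floor_lt hy0).2 hyM
    generalize ⌊y⌋₊ = Φ at *
    have hr0 : 0 ≤ (y - Φ) * arcLength ((κ : ℝ) + 1) := mul_nonneg (by linarith) hl.le
    have hr1 : (y - Φ) * arcLength ((κ : ℝ) + 1) < arcLength ((κ : ℝ) + 1) := by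
      nlinarith
    refine ⟨κ, Φ, (y - Φ) * arcLength ((κ : ℝ) + 1), hΦM, ⟨hr0, hr1.le⟩, by linarith, ?_, hcge,
      Or.inl hceil.ge⟩
    have hres := Htilde_eq_of_lt (K := κ + 1) (t := (y - Φ) * arcLength ((κ : ℝ) + 1))
      (by omega) hr0 (by push_cast; exact hr1)
    have hlog' : Htilde (1 / ((κ : ℝ) + 1 + 1)) = Real.log ((κ : ℝ) + 1 + 1) := by
      have := Htilde_one_div (K := κ + 2) (by omega)
      have e : (((κ + 2 : ℕ) : ℝ)) = (κ : ℝ) + 1 + 1 := by push_cast; ring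
      rwa [e] at this
    unfold entropyBound
    rw [hPhi, hmin, hmax, hlog, hlog']
    push_cast at hres ⊢
    have e : ktot - (Φ : ℝ) * (1 / ((κ : ℝ) + 1 + 1)) -
        ((M : ℝ) - 1 - (Φ : ℝ)) * (1 / ((κ : ℝ) + 1)) =
          1 / ((κ : ℝ) + 1) - (y - Φ) * arcLength ((κ : ℝ) + 1) := by
      rw [sub_mul y, hyl, ← hlen]; ring
    rw [e, hres, excess_arcLength hK]
    ring

end CollisionEntropy

theorem mainTheorem2 (M : ℕ) (hM : 1 ≤ M) (ktot : ℝ) (hktot_pos : 0 < ktot)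
    (hktot_le : ktot ≤ (M : ℝ))
    (𝒳 : Fin M → Type*) [∀ i, Fintype (𝒳 i)]
    (hd : ∀ i, ⌈(M : ℝ) / ktot⌉₊ ≤ Fintype.card (𝒳 i)) :
    (∀ P : (i : Fin M) → 𝒳 i → ℝ, (∀ i, P i ∈ stdSimplex ℝ (𝒳 i)) →
      ∑ i, CollisionEntropy.collisionProb (P i) ≤ ktot →
      CollisionEntropy.entropyBound M ktot ≤ ∑ i, CollisionEntropy.shannonEntropy (P i)) ∧
    (∃ P' : (i : Fin M) → 𝒳 i → ℝ, (∀ i, P' i ∈ stdSimplex ℝ (𝒳 i)) ∧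
      ∑ i, CollisionEntropy.collisionProb (P' i) ≤ ktot ∧
      ∑ i, CollisionEntropy.shannonEntropy (P' i) =
        CollisionEntropy.entropyBound M ktot) := by
  obtain ⟨κ, Φ, r, hΦ, hr, hk, hB, hc, hc'⟩ :=
    CollisionEntropy.entropyBound_eq hM hktot_pos hktot_le
  constructor
  · intro P hP hIC
    choose κ' t ht hICt hHt using fun i => CollisionEntropy.exists_arc_le_entropy (hP i)
    rw [hB]
    refine (CollisionEntropy.greedy_le_sum hM κ' t ht hΦ hr ?_).trans
      (Finset.sum_le_sum fun i _ => hHt i)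
    rw [← hk, ← Finset.sum_congr rfl (fun i _ => hICt i)]
    exact hIC
  -- Here `fill` runs over the distributions: the first `Φ` are at the end of the arc (`k_min`),
  -- number `Φ` is at `r`, the others are at its start (`k_max`).
  · obtain ⟨l, hl⟩ : ∃ l : ℕ → ℝ, l = fun _ => CollisionEntropy.arcLength ((κ : ℝ) + 1) :=
      ⟨_, rfl⟩
    have hlpos : ∀ a, 0 ≤ l a := fun a => by
      rw [hl]; exact (CollisionEntropy.arcLength_pos (by positivity)).le
    have hmem : ∀ a, CollisionEntropy.fill l Φ r a ∈
        Set.Icc 0 (CollisionEntropy.arcLength (((κ + 1 : ℕ) : ℝ))) := by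
      intro a
      have := CollisionEntropy.fill_mem (κ := Φ) (t := r) hlpos (by rw [hl]; exact hr) a
      rw [hl] at this ⊢
      push_cast
      exact this
    have hex := fun i : Fin M => CollisionEntropy.exists_distribution_of_arc (α := 𝒳 i)
      (Nat.succ_pos κ) (hmem i) (hc.trans (hd i)) (hc'.imp (fun h => h.trans (hd i)) (by
        rintro ⟨rfl, rfl⟩
        simp [CollisionEntropy.fill]))
    choose P hP hIC hH using hex
    refine ⟨P, hP, ?_, ?_⟩
    · rw [Finset.sum_congr rfl (fun i _ => hIC i), Finset.sum_sub_distrib,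
        ← Finset.sum_range (fun n => CollisionEntropy.fill l Φ r n),
        CollisionEntropy.sum_fill l Φ r (G := fun _ v => v) (fun _ => rfl) hΦ, hk, hl]
      simp
    · rw [Finset.sum_congr rfl (fun i _ => hH i), Finset.sum_add_distrib,
        ← Finset.sum_range
          (fun n => CollisionEntropy.excess ((κ + 1 : ℕ) : ℝ) (CollisionEntropy.fill l Φ r n)),
        CollisionEntropy.sum_fill l Φ r
          (G := fun _ => CollisionEntropy.excess ((κ + 1 : ℕ) : ℝ))
          (fun _ => CollisionEntropy.excess_zero _) hΦ, hB, hl]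
      simp
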